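/- Let $\mathcal U=\{u_1,\dots,u_n\}$ be a universe and $\mathcal S=(S_1,\dots,S_m)$ a finite family of subsets of $\mathcal U$, both public, and let the private input be a subset $R\subseteq\mathcal U$. Let $f=\max_{u\in\mathcal U}|\{i: u\in S_i\}|$ be the maximum degree of an element. Let $\mathrm{OPT}(R)$ be the minimum number of sets of $\mathcal S$ that together cover all elements of $R\cap\bigcup_i S_i$. For an ordering $\sigma$ of the sets of $\mathcal S$, let $\mathrm{cost}_R(\sigma)$ be the size of the implicit set cover given by $\sigma$, that is, the number of sets that are the first set in the ordering containing $u$ for at least one $u\in R\cap\bigcup_i S_i$. A randomized mechanism $M$ with input $R$ is $\varepsilon$-node differentially private if $\Pr[M(R_1)\in Y]\le e^{\varepsilon}\Pr[M(R_2)\in Y]$ for every set $Y$ of outputs and all $R_1,R_2\subseteq\mathcal U$ with $|R_1\triangle R_2|=1$. **Corollary.** There are absolute constants $C$ and $c\in\mathbb N$ and a randomized algorithm which takes $(\mathcal U,\mathcal S)$, $\varepsilon>0$ and $R$, outputs an ordering $\sigma$ of the sets of $\mathcal S$, and satisfies the following for all $n$, $m$, $\mathcal S$ and $\varepsilon>0$: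 1. for fixed $(\mathcal U,\mathcal S)$ and $\varepsilon$, the algorithm is $\varepsilon$-node differentially private; 2. if $n\ge 2$, then for every $R\subseteq\mathcal U$, with probability at least $1-1/n^2$, $$\mathrm{cost}_R(\sigma)\;\le\; C\,(\log n)^c\,\max\{1,f/\varepsilon\}\cdot \mathrm{OPT}(R).$$ In particular, whenever $\varepsilon\le f$ (for instance whenever $\varepsilon\le 1\le f$), the approximation ratio is $O(f\cdot\mathrm{polylog}(n)/\varepsilon)$ with high probability. Here an algorithm means a randomized mechanism; no running time is claimed. -/

import Mathlib

namespace PrivateSetCover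

/-- A set system `S_1, …, S_m` over the universe of `n` elements `Fin n`. -/
abbrev SetSystem (n m : ℕ) : Type := Fin m → Finset (Fin n)

/-- The degree of an element: the number of sets of the system that contain it. -/
def degree {n m : ℕ} (S : SetSystem n m) (u : Fin n) : ℕ :=
  (Finset.univ.filter fun i : Fin m => u ∈ S i).card

/-- The parameter `f`: the maximum degree of an element (`0` for the empty universe). -/
def maxDegree {n m : ℕ} (S : SetSystem n m) : ℕ :=
  Finset.univ.sup (degree S)

/-- The sets with index in `T` cover every element of `R` that lies in some set of the system. -/
def IsCover {n m : ℕ} (S : SetSystem n m) (R : Finset (Fin n)) (T : Finset (Fin m)) : Prop :=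
  ∀ u ∈ R, (∃ i, u ∈ S i) → ∃ i ∈ T, u ∈ S i

/-- The minimum number of sets in a cover of `R`. -/
noncomputable def opt {n m : ℕ} (S : SetSystem n m) (R : Finset (Fin n)) : ℕ :=
  sInf {k : ℕ | ∃ T : Finset (Fin m), IsCover S R T ∧ T.card = k}

/-- An implicit solution: an ordering of the sets, where `σ k` is the set in position `k`. -/
abbrev Ordering (m : ℕ) : Type := Equiv.Perm (Fin m)

/-- The set cover described by an ordering: the sets that are, for at least one element of `R`,
the first set in the ordering that contains this element. -/
def implicitCover {n m : ℕ} (S : SetSystem n m) (R : Finset (Fin n)) (σ : Ordering m) :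
    Finset (Fin m) :=
  Finset.univ.filter fun i : Fin m =>
    ∃ u ∈ R, u ∈ S i ∧ ∀ j : Fin m, u ∈ S j → σ.symm i ≤ σ.symm j

/-- Two private inputs are node-neighboring if they differ by exactly one element. -/
def NodeNeighbors {n : ℕ} (R₁ R₂ : Finset (Fin n)) : Prop :=
  (symmDiff R₁ R₂).card = 1

/-- Pure `ε`-node differential privacy of a randomized mechanism whose private input is the
set `R` of elements that have to be covered. -/
def IsNodeDP {n : ℕ} {β : Type} (ε : ℝ) (M : Finset (Fin n) → PMF β) : Prop :=
  ∀ R₁ R₂ : Finset (Fin n), NodeNeighbors R₁ R₂ → ∀ Y : Set β,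
    (M R₁).toOuterMeasure Y ≤ ENNReal.ofReal (Real.exp ε) * (M R₂).toOuterMeasure Y

/-- A randomized algorithm for implicit Set Cover: from the public set system, the privacy
parameter and the private set `R` it produces a random ordering of the sets. -/
abbrev ImplicitSetCoverAlgorithm : Type :=
  ∀ n m : ℕ, SetSystem n m → ℝ → Finset (Fin n) → PMF (Ordering m)

end PrivateSetCover

/-! The exponential mechanism with energy `(ε / 2) * cost_R` is `ε`-private, because changing one
element of `R` changes `cost_R` by at most one. Only `N ≤ n f` of the sets are nonempty. Sample the
prior ordering by drawing a sparse random subset of these sets and putting it in front: an optimal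
cover `T` is drawn with probability at least `exp (-1) * N ^ (-OPT)`, and the resulting ordering
costs at most `OPT`. The exponential mechanism therefore returns an ordering of cost at most
`OPT + (2 / ε) * (1 + OPT * log N + log (1 / δ))` except with probability `δ`. Taking `δ = 1 / n²`,
this is `O(OPT * (log n + log f) / ε + OPT)`, which suffices since `log f ≤ f`. -/

namespace PrivateSetCover

open Finset
open scoped ENNReal NNReal

section Probability

variable {β : Type*}

theorem toOuterMeasure_le_mul_of_apply_le {p q : PMF β} {c : ℝ≥0∞} (h : ∀ b, p b ≤ c * q b)
    (Y : Set β) : p.toOuterMeasure Y ≤ c * q.toOuterMeasure Y := by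
  rw [PMF.toOuterMeasure_apply, PMF.toOuterMeasure_apply, ← ENNReal.tsum_mul_left]
  refine ENNReal.tsum_le_tsum fun b ↦ ?_
  by_cases hb : b ∈ Y <;> simp [hb, h b]

theorem ofReal_one_sub_le_toOuterMeasure {p : PMF β} {Y : Set β} {δ : ℝ} (hδ : 0 ≤ δ)
    (h : p.toOuterMeasure Yᶜ ≤ ENNReal.ofReal δ) :
    ENNReal.ofReal (1 - δ) ≤ p.toOuterMeasure Y := by
  rw [ENNReal.ofReal_sub _ hδ, ENNReal.ofReal_one, tsub_le_iff_right]
  calc (1 : ℝ≥0∞) = p.toOuterMeasure (Y ∪ Yᶜ) := by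
        rw [Set.union_compl_self, eq_comm, PMF.toOuterMeasure_apply_eq_one_iff]
        exact Set.subset_univ _
    _ ≤ p.toOuterMeasure Y + p.toOuterMeasure Yᶜ := MeasureTheory.measure_union_le _ _
    _ ≤ p.toOuterMeasure Y + ENNReal.ofReal δ := by gcongr

theorem apply_le_map_apply {α : Type*} (p : PMF α) (f : α → β) (a : α) : p a ≤ p.map f (f a) := by
  classical
  rw [PMF.map_apply]
  simpa only [if_true] using ENNReal.le_tsum (f := fun x ↦ if f a = f x then p x else 0) a

end Probability

section ExponentialMechanism

variable {β : Type*}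

/-- The normalizing constant of the Gibbs distribution `gibbs μ E`. -/
noncomputable def partitionFunction (μ : PMF β) (E : β → ℝ) : ℝ≥0∞ :=
  ∑' b, μ b * ENNReal.ofReal (Real.exp (-E b))

theorem partitionFunction_ne_zero (μ : PMF β) (E : β → ℝ) : partitionFunction μ E ≠ 0 := by
  obtain ⟨b, hb⟩ := μ.support_nonempty
  refine fun h ↦ mul_ne_zero ((μ.mem_support_iff b).1 hb) ?_ (ENNReal.tsum_eq_zero.1 h b)
  exact (ENNReal.ofReal_pos.2 (Real.exp_pos _)).ne'

theorem partitionFunction_ne_top [Finite β] (μ : PMF β) (E : β → ℝ) :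
    partitionFunction μ E ≠ ∞ := by
  have := Fintype.ofFinite β
  rw [partitionFunction, tsum_fintype]
  exact ENNReal.sum_ne_top.2 fun b _ ↦ ENNReal.mul_ne_top (μ.apply_ne_top b) ENNReal.ofReal_ne_top

theorem partitionFunction_le_mul (μ : PMF β) {E₁ E₂ : β → ℝ} {d : ℝ} (h : ∀ b, E₂ b ≤ E₁ b + d) :
    partitionFunction μ E₁ ≤ ENNReal.ofReal (Real.exp d) * partitionFunction μ E₂ := by
  rw [partitionFunction, partitionFunction, ← ENNReal.tsum_mul_left]
  refine ENNReal.tsum_le_tsum fun b ↦ ?_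
  rw [mul_left_comm, ← ENNReal.ofReal_mul (Real.exp_nonneg d), ← Real.exp_add]
  gcongr
  linarith [h b]

/-- The Gibbs distribution with prior `μ` and energy `E`, whose density with respect to `μ` is
proportional to `exp (-E)`. With an energy that depends on private data this is the exponential
mechanism of McSherry and Talwar. -/
noncomputable def gibbs [Finite β] (μ : PMF β) (E : β → ℝ) : PMF β :=
  PMF.normalize (fun b ↦ μ b * ENNReal.ofReal (Real.exp (-E b)))
    (partitionFunction_ne_zero μ E) (partitionFunction_ne_top μ E)

variable [Finite β]

theorem gibbs_apply (μ : PMF β) (E : β → ℝ) (b : β) :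
    gibbs μ E b = μ b * ENNReal.ofReal (Real.exp (-E b)) / partitionFunction μ E :=
  PMF.normalize_apply _ _ b

theorem gibbs_apply_le (μ : PMF β) {E₁ E₂ : β → ℝ} {d : ℝ} (h : ∀ b, |E₁ b - E₂ b| ≤ d) (b : β) :
    gibbs μ E₁ b ≤ ENNReal.ofReal (Real.exp (2 * d)) * gibbs μ E₂ b := by
  have hZ : partitionFunction μ E₂ ≤ ENNReal.ofReal (Real.exp d) * partitionFunction μ E₁ :=
    partitionFunction_le_mul μ fun b ↦ by linarith [le_abs_self (E₁ b - E₂ b), h b]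
  have hw : ENNReal.ofReal (Real.exp (-E₁ b)) ≤
      ENNReal.ofReal (Real.exp d) * ENNReal.ofReal (Real.exp (-E₂ b)) := by
    rw [← ENNReal.ofReal_mul (Real.exp_nonneg d), ← Real.exp_add]
    gcongr
    linarith [neg_abs_le (E₁ b - E₂ b), h b]
  have hd : ENNReal.ofReal (Real.exp d) ≠ 0 := (ENNReal.ofReal_pos.2 (Real.exp_pos d)).ne'
  rw [gibbs_apply, gibbs_apply, two_mul, Real.exp_add, ENNReal.ofReal_mul (Real.exp_nonneg d)]
  set D := ENNReal.ofReal (Real.exp d)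
  calc μ b * ENNReal.ofReal (Real.exp (-E₁ b)) / partitionFunction μ E₁
      = D * (μ b * ENNReal.ofReal (Real.exp (-E₁ b))) / (D * partitionFunction μ E₁) :=
        (ENNReal.mul_div_mul_left _ _ hd ENNReal.ofReal_ne_top).symm
    _ ≤ D * (μ b * (D * ENNReal.ofReal (Real.exp (-E₂ b)))) / partitionFunction μ E₂ := by gcongr
    _ = D * D * (μ b * ENNReal.ofReal (Real.exp (-E₂ b)) / partitionFunction μ E₂) := by
        rw [← mul_div_assoc]
        ring_nf

theorem toOuterMeasure_gibbs_le {μ : PMF β} (E : β → ℝ) {b₀ : β} {s : ℝ}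
    (hs : ENNReal.ofReal (Real.exp (-s)) ≤ μ b₀) (t : ℝ) :
    (gibbs μ E).toOuterMeasure {b | E b₀ + s + t ≤ E b} ≤ ENNReal.ofReal (Real.exp (-t)) := by
  have hZ : ENNReal.ofReal (Real.exp (-(E b₀ + s))) ≤ partitionFunction μ E := by
    refine le_trans ?_ (ENNReal.le_tsum b₀)
    rw [neg_add_rev, Real.exp_add, ENNReal.ofReal_mul (Real.exp_nonneg _)]
    gcongr
  have hexp : ENNReal.ofReal (Real.exp (-(E b₀ + s + t))) ≤
      ENNReal.ofReal (Real.exp (-t)) * partitionFunction μ E := by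
    rw [neg_add_rev, Real.exp_add, ENNReal.ofReal_mul (Real.exp_nonneg _)]
    gcongr
  rw [← mul_one (ENNReal.ofReal _), ← μ.tsum_coe, PMF.toOuterMeasure_apply, ← ENNReal.tsum_mul_left]
  refine ENNReal.tsum_le_tsum fun b ↦ Set.indicator_apply_le' (fun hb ↦ ?_) fun _ ↦ zero_le
  rw [gibbs_apply]
  refine ENNReal.div_le_of_le_mul ?_
  rw [mul_right_comm, mul_comm]
  gcongr
  exact le_trans (by gcongr; exact hb) hexp

end ExponentialMechanism

section RandomSubset

variable {α : Type*}

theorem sum_powerset_pow_div (r : ℝ≥0) (s : Finset α) :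
    ∑ t ∈ s.powerset, r ^ #t / (r + 1) ^ #s = 1 := by
  rw [← sum_div, div_eq_one_iff_eq (by positivity), ← sum_pow_mul_eq_add_pow]
  simp only [one_pow, mul_one]

open Classical in
/-- The random subset of `s` that contains every element of `s` with odds `r : 1`, independently of
the others. -/
noncomputable def randomSubset (r : ℝ≥0) (s : Finset α) : PMF (Finset α) :=
  PMF.ofFinset (fun t ↦ if t ∈ s.powerset then ((r ^ #t / (r + 1) ^ #s : ℝ≥0) : ℝ≥0∞) else 0)
    s.powerset
    (by rw [sum_ite_mem, inter_self, ← ENNReal.ofNNReal_finsetSum, sum_powerset_pow_div,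
      ENNReal.coe_one])
    fun _ ht ↦ if_neg ht

theorem randomSubset_apply (r : ℝ≥0) {s t : Finset α} (h : t ⊆ s) :
    randomSubset r s t = ((r ^ #t / (r + 1) ^ #s : ℝ≥0) : ℝ≥0∞) :=
  if_pos (mem_powerset.2 h)

theorem exp_neg_le_randomSubset_apply {s t : Finset α} (hs : s.Nonempty) (h : t ⊆ s) :
    ENNReal.ofReal (Real.exp (-(1 + #t * Real.log #s))) ≤ randomSubset (#s : ℝ≥0)⁻¹ s t := by
  have hs₀ : (0 : ℝ) < #s := by exact_mod_cast hs.card_pos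
  rw [randomSubset_apply _ h, ← ENNReal.ofReal_coe_nnreal]
  push_cast
  gcongr
  -- At odds `1 / #s` the normalization costs only a constant factor.
  have hpow : ((#s : ℝ)⁻¹ + 1) ^ #s ≤ Real.exp 1 := by
    calc ((#s : ℝ)⁻¹ + 1) ^ #s ≤ Real.exp (#s : ℝ)⁻¹ ^ #s := by
          gcongr
          exact Real.add_one_le_exp _
      _ = Real.exp 1 := by rw [← Real.exp_nat_mul, mul_inv_cancel₀ hs₀.ne']
  calc Real.exp (-(1 + #t * Real.log #s)) = (#s : ℝ)⁻¹ ^ #t / Real.exp 1 := by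
        rw [neg_add_rev, Real.exp_add, ← mul_neg, ← Real.log_inv, Real.exp_nat_mul,
          Real.exp_log (inv_pos.2 hs₀), Real.exp_neg 1, div_eq_mul_inv]
    _ ≤ (#s : ℝ)⁻¹ ^ #t / ((#s : ℝ)⁻¹ + 1) ^ #s := by gcongr

end RandomSubset

section Cover

variable {n m : ℕ} {S : SetSystem n m} {R : Finset (Fin n)} {T : Finset (Fin m)}

theorem implicitCover_mono (σ : Ordering m) {R₁ R₂ : Finset (Fin n)} (h : R₁ ⊆ R₂) :
    implicitCover S R₁ σ ⊆ implicitCover S R₂ σ :=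
  monotone_filter_right _ fun _ _ ⟨u, hu, hfirst⟩ ↦ ⟨u, h hu, hfirst⟩

theorem implicitCover_union (σ : Ordering m) (R₁ R₂ : Finset (Fin n)) :
    implicitCover S (R₁ ∪ R₂) σ = implicitCover S R₁ σ ∪ implicitCover S R₂ σ := by
  simp only [implicitCover, mem_union, or_and_right, exists_or, filter_or]

theorem card_implicitCover_le_card (σ : Ordering m) : #(implicitCover S R σ) ≤ #R := by
  refine card_le_card_of_forall_subsingleton
    (fun i u ↦ u ∈ S i ∧ ∀ j, u ∈ S j → σ.symm i ≤ σ.symm j) (fun i hi ↦ (mem_filter.1 hi).2) ?_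
  rintro u - i ⟨-, hui, hi⟩ j ⟨-, huj, hj⟩
  exact σ.symm.injective (le_antisymm (hi j huj) (hj i hui))

theorem card_implicitCover_le_card_symmDiff_add (σ : Ordering m) (R₁ R₂ : Finset (Fin n)) :
    #(implicitCover S R₁ σ) ≤ #(symmDiff R₁ R₂) + #(implicitCover S R₂ σ) := by
  calc #(implicitCover S R₁ σ)
      ≤ #(implicitCover S (symmDiff R₁ R₂ ∪ R₂) σ) :=
        card_le_card (implicitCover_mono σ (le_symmDiff_sup_right R₁ R₂))
    _ ≤ #(implicitCover S (symmDiff R₁ R₂) σ) + #(implicitCover S R₂ σ) := by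
        rw [implicitCover_union]
        exact card_union_le _ _
    _ ≤ #(symmDiff R₁ R₂) + #(implicitCover S R₂ σ) := by
        gcongr
        exact card_implicitCover_le_card σ

theorem NodeNeighbors.abs_card_implicitCover_sub_le {R₁ R₂ : Finset (Fin n)}
    (h : NodeNeighbors R₁ R₂) (S : SetSystem n m) (σ : Ordering m) :
    |(#(implicitCover S R₁ σ) : ℝ) - #(implicitCover S R₂ σ)| ≤ 1 := by
  have h₁₂ := card_implicitCover_le_card_symmDiff_add (S := S) σ R₁ R₂
  have h₂₁ := card_implicitCover_le_card_symmDiff_add (S := S) σ R₂ R₁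
  rw [symmDiff_comm] at h₂₁
  rw [show #(symmDiff R₁ R₂) = 1 from h] at h₁₂ h₂₁
  rify at h₁₂ h₂₁
  exact abs_sub_le_iff.2 ⟨by linarith, by linarith⟩

/-- An ordering in which the sets with index in `T` precede all others. -/
def frontOrdering (T : Finset (Fin m)) : Ordering m :=
  Tuple.sort fun i ↦ if i ∈ T then 0 else 1

theorem mem_of_frontOrdering_symm_le {i j : Fin m} (hi : i ∈ T)
    (h : (frontOrdering T).symm j ≤ (frontOrdering T).symm i) : j ∈ T := by
  have hmono := Tuple.monotone_sort (fun i ↦ if i ∈ T then 0 else 1) h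
  by_contra hj
  simp [frontOrdering, hi, hj] at hmono

theorem IsCover.implicitCover_frontOrdering_subset (h : IsCover S R T) :
    implicitCover S R (frontOrdering T) ⊆ T := by
  intro i hi
  obtain ⟨u, hu, hui, hfirst⟩ := (mem_filter.1 hi).2
  obtain ⟨j, hj, huj⟩ := h u hu ⟨i, hui⟩
  exact mem_of_frontOrdering_symm_le hj (hfirst j huj)

theorem IsCover.implicitCover_eq_empty (h : IsCover S R ∅) (σ : Ordering m) :
    implicitCover S R σ = ∅ := by
  refine filter_eq_empty_iff.2 fun i _ ⟨u, hu, hui, _⟩ ↦ ?_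
  obtain ⟨j, hj, -⟩ := h u hu ⟨i, hui⟩
  exact notMem_empty j hj

theorem IsCover.opt_le_card (h : IsCover S R T) : opt S R ≤ #T :=
  Nat.sInf_le ⟨T, h, rfl⟩

variable (S) in
/-- The indices of the nonempty sets of the system, the only ones a cover needs. -/
def nonemptySets : Finset (Fin m) := {i | (S i).Nonempty}

theorem IsCover.inter_nonemptySets (h : IsCover S R T) : IsCover S R (T ∩ nonemptySets S) := by
  intro u hu hex
  obtain ⟨i, hi, hui⟩ := h u hu hex
  exact ⟨i, mem_inter.2 ⟨hi, mem_filter.2 ⟨mem_univ i, u, hui⟩⟩, hui⟩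

variable (S R) in
theorem exists_isCover_subset_nonemptySets :
    ∃ T ⊆ nonemptySets S, IsCover S R T ∧ #T = opt S R := by
  have hne : {k | ∃ T, IsCover S R T ∧ #T = k}.Nonempty :=
    ⟨_, univ, fun _ _ ⟨i, hi⟩ ↦ ⟨i, mem_univ i, hi⟩, rfl⟩
  obtain ⟨T, hT, hcard⟩ : ∃ T, IsCover S R T ∧ #T = opt S R := Nat.sInf_mem hne
  exact ⟨_, inter_subset_right, hT.inter_nonemptySets,
    ((card_le_card inter_subset_left).trans hcard.le).antisymm hT.inter_nonemptySets.opt_le_card⟩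

theorem nonemptySets_nonempty (h : 0 < opt S R) : (nonemptySets S).Nonempty := by
  obtain ⟨T, hTN, -, hcard⟩ := exists_isCover_subset_nonemptySets S R
  exact (card_pos.1 (hcard ▸ h)).mono hTN

variable (S) in
theorem card_nonemptySets_le : #(nonemptySets S) ≤ n * maxDegree S := by
  have hsub : nonemptySets S ⊆ univ.biUnion fun u ↦ {i | u ∈ S i} := fun i hi ↦ by
    obtain ⟨u, hu⟩ := (mem_filter.1 hi).2
    exact mem_biUnion.2 ⟨u, mem_univ u, mem_filter.2 ⟨mem_univ i, hu⟩⟩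
  calc #(nonemptySets S) ≤ #(univ : Finset (Fin n)) * maxDegree S :=
        (card_le_card hsub).trans <| card_biUnion_le_card_mul _ _ _ fun u _ ↦
          le_sup (f := degree S) (mem_univ u)
    _ = n * maxDegree S := by rw [card_univ, Fintype.card_fin]

end Cover

section Mechanism

variable {n m : ℕ} (S : SetSystem n m)

/-- The public prior of the mechanism: a sparse random family of nonempty sets is put in front. -/
noncomputable def orderingPrior : PMF (Ordering m) :=
  (randomSubset (#(nonemptySets S) : ℝ≥0)⁻¹ (nonemptySets S)).map frontOrdering

variable {S} in
theorem exp_neg_le_orderingPrior_apply {T : Finset (Fin m)} (hT : T.Nonempty)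
    (h : T ⊆ nonemptySets S) :
    ENNReal.ofReal (Real.exp (-(1 + #T * Real.log #(nonemptySets S)))) ≤
      orderingPrior S (frontOrdering T) :=
  (exp_neg_le_randomSubset_apply (hT.mono h) h).trans (apply_le_map_apply _ _ T)

/-- The exponential mechanism that favours orderings with a small implicit cover. The factor `1 / 2`
compensates for the normalizing constant, which also depends on the private input. -/
noncomputable def privateOrdering (ε : ℝ) (R : Finset (Fin n)) : PMF (Ordering m) :=
  gibbs (orderingPrior S) fun σ ↦ ε / 2 * #(implicitCover S R σ)

theorem privateOrdering_isNodeDP {ε : ℝ} (hε : 0 ≤ ε) : IsNodeDP ε (privateOrdering S ε) := by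
  intro R₁ R₂ h Y
  have henergy (σ : Ordering m) :
      |ε / 2 * #(implicitCover S R₁ σ) - ε / 2 * #(implicitCover S R₂ σ)| ≤ ε / 2 := by
    rw [← mul_sub, abs_mul, abs_of_nonneg (by positivity)]
    exact mul_le_of_le_one_right (by positivity) (h.abs_card_implicitCover_sub_le S σ)
  have hgibbs := toOuterMeasure_le_mul_of_apply_le (gibbs_apply_le (orderingPrior S) henergy) Y
  rwa [mul_div_cancel₀ ε two_ne_zero] at hgibbs

/-- The approximation ratio that `privateOrdering S ε` exceeds with probability at most `δ`. -/
noncomputable def approxRatio (ε δ : ℝ) : ℝ :=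
  1 + 2 / ε * (1 + Real.log #(nonemptySets S) + Real.log δ⁻¹)

theorem privateOrdering_accuracy {ε δ : ℝ} (hε : 0 < ε) (hδ : 0 < δ) (hδ₁ : δ ≤ 1)
    (R : Finset (Fin n)) :
    ENNReal.ofReal (1 - δ) ≤ (privateOrdering S ε R).toOuterMeasure
      {σ | (#(implicitCover S R σ) : ℝ) ≤ approxRatio S ε δ * opt S R} := by
  obtain ⟨T, hTN, hT, hcard⟩ := exists_isCover_subset_nonemptySets S R
  refine ofReal_one_sub_le_toOuterMeasure hδ.le ?_
  obtain rfl | hTne := T.eq_empty_or_nonempty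
  · simp [hT.implicitCover_eq_empty, ← hcard]
  set N := #(nonemptySets S)
  set a := ε / 2 * (#(implicitCover S R (frontOrdering T)) : ℝ)
  have hcost : (#(implicitCover S R (frontOrdering T)) : ℝ) ≤ opt S R := by
    exact_mod_cast hcard ▸ card_le_card hT.implicitCover_frontOrdering_subset
  have hopt : (1 : ℝ) ≤ opt S R := by exact_mod_cast hcard ▸ hTne.card_pos
  have hlog : 0 ≤ Real.log δ⁻¹ := Real.log_nonneg ((one_le_inv₀ hδ).2 hδ₁)
  have hthreshold : a + (1 + #T * Real.log N) + Real.log δ⁻¹ ≤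
      ε / 2 * (approxRatio S ε δ * opt S R) := by
    calc a + (1 + #T * Real.log N) + Real.log δ⁻¹
        ≤ ε / 2 * opt S R + (opt S R + opt S R * Real.log N) + opt S R * Real.log δ⁻¹ := by
          rw [hcard]
          gcongr
          · exact mul_le_mul_of_nonneg_left hcost (by positivity)
          · exact le_mul_of_one_le_left hlog hopt
      _ = ε / 2 * (approxRatio S ε δ * opt S R) := by
          rw [approxRatio]
          field_simp
          ring
  calc (privateOrdering S ε R).toOuterMeasure
        {σ | (#(implicitCover S R σ) : ℝ) ≤ approxRatio S ε δ * opt S R}ᶜ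
      ≤ (privateOrdering S ε R).toOuterMeasure
        {σ | a + (1 + #T * Real.log N) + Real.log δ⁻¹ ≤ ε / 2 * #(implicitCover S R σ)} :=
        MeasureTheory.measure_mono fun σ hσ ↦ by
          have hσ : approxRatio S ε δ * opt S R < #(implicitCover S R σ) := not_le.1 hσ
          exact hthreshold.trans (by gcongr)
    _ ≤ ENNReal.ofReal (Real.exp (-Real.log δ⁻¹)) :=
        toOuterMeasure_gibbs_le _ (exp_neg_le_orderingPrior_apply hTne hTN) _
    _ = ENNReal.ofReal δ := by rw [Real.log_inv, neg_neg, Real.exp_log hδ]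

variable {S} in
theorem approxRatio_le {ε : ℝ} (hε : 0 < ε) (hn : 2 ≤ n) (hS : (nonemptySets S).Nonempty) :
    approxRatio S ε (1 / n ^ 2) ≤ 11 * Real.log n * max 1 (maxDegree S / ε) := by
  have hNnf : 1 ≤ n * maxDegree S := hS.card_pos.trans_le (card_nonemptySets_le S)
  have hf : (1 : ℝ) ≤ maxDegree S := by exact_mod_cast Nat.pos_of_mul_pos_left hNnf
  have hlogN : Real.log #(nonemptySets S) ≤ Real.log n + (maxDegree S - 1) := by
    calc Real.log #(nonemptySets S) ≤ Real.log (n * maxDegree S) :=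
          Real.log_le_log (by exact_mod_cast hS.card_pos) (by exact_mod_cast card_nonemptySets_le S)
      _ = Real.log n + Real.log (maxDegree S) := Real.log_mul (by positivity) (by positivity)
      _ ≤ _ := by gcongr; exact Real.log_le_sub_one_of_pos (by positivity)
  have hlogn : 3 / 5 ≤ Real.log n := by
    have : Real.log 2 ≤ Real.log n := Real.log_le_log (by norm_num) (by exact_mod_cast hn)
    linarith [Real.log_two_gt_d9]
  set f : ℝ := (maxDegree S : ℝ)
  have hlogs : 1 + Real.log #(nonemptySets S) + 2 * Real.log n ≤ (3 * Real.log n + 1) * f := by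
    calc 1 + Real.log #(nonemptySets S) + 2 * Real.log n ≤ 3 * Real.log n + f := by linarith
      _ ≤ 3 * Real.log n * f + f := by
          linarith [le_mul_of_one_le_right (show 0 ≤ 3 * Real.log n by linarith) hf]
      _ = (3 * Real.log n + 1) * f := by ring
  calc approxRatio S ε (1 / n ^ 2)
      = 1 + 2 / ε * (1 + Real.log #(nonemptySets S) + 2 * Real.log n) := by
        rw [approxRatio, one_div, inv_inv, Real.log_pow, Nat.cast_two]
    _ ≤ 1 + 2 / ε * ((3 * Real.log n + 1) * f) := by gcongr
    _ = 1 + (2 + 6 * Real.log n) * (f / ε) := by ring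
    _ ≤ max 1 (f / ε) + (2 + 6 * Real.log n) * max 1 (f / ε) := by
        gcongr
        exacts [le_max_left _ _, le_max_right _ _]
    _ = (3 + 6 * Real.log n) * max 1 (f / ε) := by ring
    _ ≤ 11 * Real.log n * max 1 (f / ε) := by
        gcongr
        linarith

end Mechanism

end PrivateSetCover

theorem mainTheorem5 :
    ∃ (C : ℝ) (c : ℕ) (A : PrivateSetCover.ImplicitSetCoverAlgorithm),
      ∀ (n m : ℕ) (S : PrivateSetCover.SetSystem n m) (ε : ℝ), 0 < ε →
        PrivateSetCover.IsNodeDP ε (A n m S ε) ∧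
        (2 ≤ n → ∀ R : Finset (Fin n),
          ENNReal.ofReal (1 - 1 / (n : ℝ) ^ 2) ≤
            (A n m S ε R).toOuterMeasure
              {σ | ((PrivateSetCover.implicitCover S R σ).card : ℝ) ≤
                C * Real.log n ^ c * max 1 ((PrivateSetCover.maxDegree S : ℝ) / ε) *
                  (PrivateSetCover.opt S R : ℝ)}) := by
  refine ⟨11, 1, fun _ _ S ε R ↦ PrivateSetCover.privateOrdering S ε R, fun n m S ε hε ↦
    ⟨PrivateSetCover.privateOrdering_isNodeDP S hε.le, fun hn R ↦ ?_⟩⟩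
  have hδ : 1 / (n : ℝ) ^ 2 ≤ 1 := by
    rw [one_div, ← inv_pow]
    exact pow_le_one₀ (by positivity) (Nat.cast_inv_le_one n)
  refine (PrivateSetCover.privateOrdering_accuracy S hε (by positivity) hδ R).trans
    (MeasureTheory.measure_mono (Set.ofPred_subset_ofPred.2 fun σ hσ ↦ hσ.trans ?_))
  obtain hopt | hopt := (PrivateSetCover.opt S R).eq_zero_or_pos
  · rw [hopt, Nat.cast_zero, mul_zero, mul_zero]
  · rw [pow_one]
    gcongr
    exact PrivateSetCover.approxRatio_le hε hn (PrivateSetCover.nonemptySets_nonempty hopt)
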